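/- Consider the Gaussian linear model $y=X\beta+\varepsilon$, $\varepsilon\sim N(0,\sigma^2I_n)$, $\sigma>0$ known, with an $n\times p$ design matrix $X$ of rank $r$, any $r$ columns of which are linearly independent. Fix $\gamma>0$ and put $c(\gamma)=8(\gamma+3/4)^2$. A model is a set $M\subseteq\{1,\dots,p\}$ of predictors with $|M|\le r$; with $D_M$ its diagonal $0/1$ indicator matrix, $\hat\beta_M=(D_MX'XD_M)^+D_MX'y$ is the least squares estimate ($^+$ is the Moore–Penrose inverse). Let $\pi$ be a probability distribution on $\{0,\dots,r\}$ with $\pi(k)>0$ for all $k\le r$. The MAP selector $\hat M=\hat M(y)$ is a (measurable) minimizer over models $M$ of $\|y-X\hat\beta_M\|^2+Pen(|M|)$, where $$Pen(k)=2\sigma^2(1+1/\gamma)\ln\Big\{\tbinom pk\pi(k)^{-1}(1+\gamma)^{k/2}\Big\}\ (0\le k<r),\qquad Pen(r)=2\sigma^2(1+1/\gamma)\ln\Big\{\pi(r)^{-1}(1+\gamma)^{r/2}\Big\}.$$ **Theorem.** For every $\gamma>0$ and every constant $c>c(\gamma)$ there is a constant $C_1=C_1(\gamma,c)>0$, depending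 only on $\gamma$ and $c$, such that the following holds for all $n,p,\sigma,X,\pi,\hat M$ as above and all $1\le p_0\le r$. Assume (P): $\pi(k)\le\binom pk e^{-c(\gamma)k}$ for $k=0,\dots,r-1$ and $\pi(r)\le e^{-c(\gamma)r}$. Assume in addition that $\pi(p_0)\ge(p_0/(pe))^{cp_0}$ if $p_0<r$, or $\pi(r)\ge e^{-cr}$ if $p_0=r$. Then $$\sup_{\beta:\|\beta\|_0\le p_0}E\|X\hat\beta_{\hat M}-X\beta\|^2\le C_1\sigma^2\,p_0\big(\ln(p/p_0)+1\big),$$ and if also $\pi(r)\ge e^{-cr}$ (which for $p_0=r$ is already assumed), then $$\sup_{\beta:\|\beta\|_0\le p_0}E\|X\hat\beta_{\hat M}-X\beta\|^2\le C_1\sigma^2\min\big(p_0(\ln(p/p_0)+1),\,r\big).$$ -/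

import Mathlib

noncomputable section

namespace MAPSelection

open Matrix MeasureTheory ProbabilityTheory

/-- The Moore-Penrose inverse of a real symmetric matrix: in an orthonormal eigenbasis every
nonzero eigenvalue is inverted and the eigenvalue `0` is kept (`0⁻¹ = 0`). -/
def pinv {ι : Type} [Fintype ι] [DecidableEq ι] {A : Matrix ι ι ℝ} (hA : A.IsHermitian) :
    Matrix ι ι ℝ :=
  (hA.eigenvectorUnitary : Matrix ι ι ℝ) * diagonal (fun i => (hA.eigenvalues i)⁻¹) *
    star (hA.eigenvectorUnitary : Matrix ι ι ℝ)

/-- `pinv` satisfies the four Penrose equations, which characterize the Moore-Penrose inverse. -/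
theorem pinv_penrose {ι : Type} [Fintype ι] [DecidableEq ι] {A : Matrix ι ι ℝ}
    (hA : A.IsHermitian) :
    A * pinv hA * A = A ∧ pinv hA * A * pinv hA = pinv hA ∧
      (A * pinv hA).IsHermitian ∧ (pinv hA * A).IsHermitian := by
  have key : ∃ U : Matrix ι ι ℝ, ∃ l : ι → ℝ, star U * U = 1 ∧
      A = U * diagonal l * star U ∧ pinv hA = U * diagonal (fun i => (l i)⁻¹) * star U := by
    refine ⟨hA.eigenvectorUnitary, hA.eigenvalues, Unitary.coe_star_mul_self _, ?_, rfl⟩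
    have h := hA.spectral_theorem
    rw [Unitary.conjStarAlgAut_apply] at h
    exact h
  obtain ⟨U, l, hU, h1, h2⟩ := key
  have prod : ∀ a b : ι → ℝ, (U * diagonal a * star U) * (U * diagonal b * star U) =
      U * diagonal (fun i => a i * b i) * star U := by
    intro a b
    rw [← diagonal_mul_diagonal]
    calc _ = U * diagonal a * (star U * U) * diagonal b * star U := by
          simp only [Matrix.mul_assoc]
      _ = _ := by rw [hU]; simp only [Matrix.mul_assoc, Matrix.one_mul]
  have herm : ∀ a : ι → ℝ, (U * diagonal a * star U).IsHermitian := by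
    intro a
    simp [Matrix.IsHermitian, Matrix.star_eq_conjTranspose, Matrix.mul_assoc]
  rw [h2]
  refine ⟨?_, ?_, ?_, ?_⟩
  · conv_lhs => rw [h1]
    rw [prod, prod]
    conv_rhs => rw [h1]
    simp
  · conv_lhs => rw [h1]
    rw [prod, prod]
    congr 3
    funext i
    by_cases hi : l i = 0 <;> simp [hi]
  · rw [h1, prod]; exact herm _
  · rw [h1, prod]; exact herm _

/-- The diagonal indicator matrix `D_M` of a model, that is, of a set `M` of predictors. -/
def modelMatrix {p : ℕ} (M : Finset (Fin p)) : Matrix (Fin p) (Fin p) ℝ :=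
  diagonal (fun j => if j ∈ M then 1 else 0)

/-- The matrix `D_M X' X D_M`. -/
def modelGram {n p : ℕ} (X : Matrix (Fin n) (Fin p) ℝ) (M : Finset (Fin p)) :
    Matrix (Fin p) (Fin p) ℝ :=
  modelMatrix M * Xᵀ * X * modelMatrix M

theorem modelGram_isHermitian {n p : ℕ} (X : Matrix (Fin n) (Fin p) ℝ) (M : Finset (Fin p)) :
    (modelGram X M).IsHermitian := by
  simp [Matrix.IsHermitian, modelGram, modelMatrix, Matrix.mul_assoc]

/-- The least squares estimate `(D_M X' X D_M)⁺ D_M X' y` of the coefficients in the model `M`. -/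
def lse {n p : ℕ} (X : Matrix (Fin n) (Fin p) ℝ) (M : Finset (Fin p))
    (y : EuclideanSpace ℝ (Fin n)) : Fin p → ℝ :=
  (pinv (modelGram_isHermitian X M) * modelMatrix M * Xᵀ) *ᵥ y.ofLp

/-- The mean vector `X b`, as a vector of Euclidean space. -/
def meanVec {n p : ℕ} (X : Matrix (Fin n) (Fin p) ℝ) (b : Fin p → ℝ) :
    EuclideanSpace ℝ (Fin n) :=
  WithLp.toLp 2 (X *ᵥ b)

/-- The law `N(Xβ, σ² I)` of the observation `y = Xβ + ε`, `ε ∼ N(0, σ² I)`. -/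
def obsLaw {n p : ℕ} (X : Matrix (Fin n) (Fin p) ℝ) (σ : ℝ) (β : Fin p → ℝ) :
    Measure (EuclideanSpace ℝ (Fin n)) :=
  multivariateGaussian (meanVec X β) (σ ^ 2 • (1 : Matrix (Fin n) (Fin n) ℝ))

/-- Any `rank X` columns of the design matrix are linearly independent. -/
def ColumnsInGeneralPosition {n p : ℕ} (X : Matrix (Fin n) (Fin p) ℝ) : Prop :=
  ∀ S : Finset (Fin p), S.card = X.rank →
    LinearIndependent ℝ (fun j : S => X.col (j : Fin p))

/-- A prior distribution on the model size, with support exactly `{0, …, r}`. -/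
structure IsSizePrior (r : ℕ) (prior : ℕ → ℝ) : Prop where
  pos : ∀ k ≤ r, 0 < prior k
  eq_zero : ∀ k, r < k → prior k = 0
  sum_eq_one : ∑ k ∈ Finset.range (r + 1), prior k = 1

/-- The constant `c(γ) = 8 (γ + 3/4)²`. -/
def cGamma (γ : ℝ) : ℝ := 8 * (γ + 3 / 4) ^ 2

/-- Assumption (P) on the prior: `π(k) ≤ C(p,k) e^{-c(γ)k}` for `k < r`, `π(r) ≤ e^{-c(γ)r}`. -/
def AssumptionP (γ : ℝ) (p r : ℕ) (prior : ℕ → ℝ) : Prop :=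
  (∀ k < r, prior k ≤ (p.choose k : ℝ) * Real.exp (-cGamma γ * k)) ∧
    prior r ≤ Real.exp (-cGamma γ * r)

/-- The complexity penalty. The models of size `r` all give the same fit and count as
a single saturated model, so the binomial coefficient is replaced by `1` for `k = r`. -/
def pen (γ σ : ℝ) (p r : ℕ) (prior : ℕ → ℝ) (k : ℕ) : ℝ :=
  2 * σ ^ 2 * (1 + 1 / γ) *
    Real.log ((if k = r then 1 else (p.choose k : ℝ)) * (prior k)⁻¹ *
      (1 + γ) ^ ((k : ℝ) / 2))

/-- The MAP criterion `‖y - X β̂_M‖² + Pen(|M|)`. -/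
def mapCriterion {n p : ℕ} (γ σ : ℝ) (X : Matrix (Fin n) (Fin p) ℝ) (prior : ℕ → ℝ)
    (y : EuclideanSpace ℝ (Fin n)) (M : Finset (Fin p)) : ℝ :=
  ‖y - meanVec X (lse X M y)‖ ^ 2 + pen γ σ p X.rank prior M.card

/-- A MAP model selector: a measurable choice, for every observation `y`, of a minimizer of the
MAP criterion over the models in the support of the prior (those of size at most `rank X`). -/
structure IsMAPSelector {n p : ℕ} (γ σ : ℝ) (X : Matrix (Fin n) (Fin p) ℝ) (prior : ℕ → ℝ)
    (Mhat : EuclideanSpace ℝ (Fin n) → Finset (Fin p)) : Prop where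
  measurable : Measurable Mhat
  card_le : ∀ y, (Mhat y).card ≤ X.rank
  minimizes : ∀ y, ∀ M : Finset (Fin p), M.card ≤ X.rank →
    mapCriterion γ σ X prior y (Mhat y) ≤ mapCriterion γ σ X prior y M

/-- The quadratic risk `E ‖X β̂_{M̂} - X β‖²` at `β`, as an extended nonnegative number. -/
def risk {n p : ℕ} (σ : ℝ) (X : Matrix (Fin n) (Fin p) ℝ)
    (Mhat : EuclideanSpace ℝ (Fin n) → Finset (Fin p)) (β : Fin p → ℝ) : ENNReal :=
  ∫⁻ y, ENNReal.ofReal (‖meanVec X (lse X (Mhat y) y) - meanVec X β‖ ^ 2) ∂(obsLaw X σ β)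

/-- The maximal risk over all `β` with at most `p₀` nonzero entries. -/
def maxRisk {n p : ℕ} (σ : ℝ) (X : Matrix (Fin n) (Fin p) ℝ)
    (Mhat : EuclideanSpace ℝ (Fin n) → Finset (Fin p)) (p₀ : ℕ) : ENNReal :=
  ⨆ β ∈ {β : Fin p → ℝ | hammingNorm β ≤ p₀}, risk σ X Mhat β

end MAPSelection

end

/-! Let `v` = Xβ lie in the span of a reference model M₀, and let f be the selected fit, of size k.
Comparing criteria at M̂ and M₀ and splitting the cross term by Young's inequality
(`sq_norm_fit_sub_le`) bounds ‖f - v‖², up to a factor, by t‖P_S ε‖² - Pen(k) + Pen(|M₀|), where S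
contains the spans of both models.

M̂ is random, so P_S ε is controlled for all models at once by exponential moments. For a fixed
model, ‖P_S ε‖²/σ² is chi-square with at most k + |M₀| degrees of freedom, and the penalty is large
enough that the exponential of the centred term has mean at most π(k)/C(p,k), or π(r) when k = r
(`lintegral_exp_excess_le`). Summed over models, these means total at most ∑ π(k) = 1
(`lintegral_totalExcess_le_one`). Since x ≤ exp x and each exponential is at most the sum, this
gives the oracle inequality `risk_le`: the risk is of order σ²(1 + |M₀|) + Pen(|M₀|).

It remains to choose M₀: a set of size p₀ containing the support of β gives the sparse rate, and any
set of size r gives the rate r. -/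

noncomputable section

namespace MAPSelection

open Matrix MeasureTheory ProbabilityTheory

variable {n p : ℕ}

/-! ### Column spans of models and their dimensions. -/

/-- The span of the columns of `X` with index in `M`. -/
def modelSpace (X : Matrix (Fin n) (Fin p) ℝ) (M : Finset (Fin p)) :
    Submodule ℝ (EuclideanSpace ℝ (Fin n)) :=
  Submodule.span ℝ ((fun j => WithLp.toLp 2 (X.col j)) '' (M : Set (Fin p)))

theorem meanVec_eq_sum (X : Matrix (Fin n) (Fin p) ℝ) (b : Fin p → ℝ) :
    meanVec X b = ∑ j, b j • (WithLp.toLp 2 (X.col j) : EuclideanSpace ℝ (Fin n)) := by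
  ext i
  simp [meanVec, Matrix.mulVec, dotProduct, mul_comm]

theorem meanVec_mem_modelSpace (X : Matrix (Fin n) (Fin p) ℝ) {M : Finset (Fin p)}
    {b : Fin p → ℝ} (hb : ∀ j ∉ M, b j = 0) : meanVec X b ∈ modelSpace X M := by
  rw [meanVec_eq_sum]
  refine Submodule.sum_mem _ fun j _ => ?_
  by_cases hj : j ∈ M
  · exact Submodule.smul_mem _ _ (Submodule.subset_span ⟨j, hj, rfl⟩)
  · simp [hb j hj]

theorem modelSpace_mono (X : Matrix (Fin n) (Fin p) ℝ) {M N : Finset (Fin p)} (h : M ⊆ N) :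
    modelSpace X M ≤ modelSpace X N :=
  Submodule.span_mono (Set.image_mono (by exact_mod_cast h))

theorem finrank_modelSpace_le (X : Matrix (Fin n) (Fin p) ℝ) (M : Finset (Fin p)) :
    Module.finrank ℝ (modelSpace X M) ≤ M.card := by
  classical
  have h := finrank_span_finset_le_card (R := ℝ)
    (M.image fun j => (WithLp.toLp 2 (X.col j) : EuclideanSpace ℝ (Fin n)))
  rw [Set.finrank, Finset.coe_image] at h
  exact h.trans Finset.card_image_le

theorem finrank_modelSpace_univ (X : Matrix (Fin n) (Fin p) ℝ) :
    Module.finrank ℝ (modelSpace X Finset.univ) = X.rank := by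
  rw [Matrix.rank_eq_finrank_span_cols]
  have h : modelSpace X Finset.univ = (Submodule.span ℝ (Set.range X.col)).map
      ((WithLp.linearEquiv 2 ℝ (Fin n → ℝ)).symm : (Fin n → ℝ) →ₗ[ℝ] _) := by
    rw [Submodule.map_span, modelSpace, Finset.coe_univ, Set.image_univ, ← Set.range_comp]
    rfl
  rw [h]
  exact LinearEquiv.finrank_map_eq _ _

/-- General position makes the smaller space r-dimensional, and it sits inside a space of dimension
r. -/
theorem modelSpace_eq_univ {X : Matrix (Fin n) (Fin p) ℝ} (hX : ColumnsInGeneralPosition X)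
    {M : Finset (Fin p)} (hM : M.card = X.rank) :
    modelSpace X M = modelSpace X Finset.univ := by
  refine Submodule.eq_of_le_of_finrank_eq (modelSpace_mono X (Finset.subset_univ M)) ?_
  rw [finrank_modelSpace_univ, ← hM]
  have h := (hX M hM).map' (WithLp.linearEquiv 2 ℝ (Fin n → ℝ)).symm.toLinearMap
    (LinearEquiv.ker _)
  have h2 := finrank_span_eq_card h
  rw [Fintype.card_coe] at h2
  rw [← h2, modelSpace, ← Subtype.range_coe (s := (M : Set (Fin p))), ← Set.range_comp]
  rfl

/-! ### The least squares fit as an orthogonal projection. -/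

theorem modelMatrix_mul_self (M : Finset (Fin p)) :
    modelMatrix M * modelMatrix M = modelMatrix M := by
  simp [modelMatrix]

theorem modelMatrix_transpose (M : Finset (Fin p)) : (modelMatrix M)ᵀ = modelMatrix M := by
  simp [modelMatrix]

/-- With P the pseudoinverse of the Gram matrix G, the Penrose equations give P = PGP = GPᵀP, and
D_M fixes G from the left. -/
theorem modelMatrix_mul_pinv (X : Matrix (Fin n) (Fin p) ℝ) (M : Finset (Fin p)) :
    modelMatrix M * pinv (modelGram_isHermitian X M) = pinv (modelGram_isHermitian X M) := by
  obtain ⟨-, h2, -, h4⟩ := pinv_penrose (modelGram_isHermitian X M)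
  set P := pinv (modelGram_isHermitian X M)
  have h5 : P * modelGram X M = modelGram X M * Pᵀ := by
    have h6 := h4.eq
    rw [Matrix.conjTranspose_mul, (modelGram_isHermitian X M).eq,
      Matrix.conjTranspose_eq_transpose_of_trivial] at h6
    exact h6.symm
  have h7 : modelMatrix M * modelGram X M = modelGram X M := by
    simp only [modelGram, ← Matrix.mul_assoc, modelMatrix_mul_self]
  rw [← h2, h5, ← Matrix.mul_assoc, ← Matrix.mul_assoc, h7]

/-- Write A = D_M X' and G = AAᵀ. The difference Z = GPA - A satisfies ZAᵀ = GPG - G = 0, hence ZZᵀ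
= 0 and Z = 0. -/
theorem modelGram_mul_pinv_mul (X : Matrix (Fin n) (Fin p) ℝ) (M : Finset (Fin p)) :
    modelGram X M * pinv (modelGram_isHermitian X M) * (modelMatrix M * Xᵀ) =
      modelMatrix M * Xᵀ := by
  obtain ⟨h1, -, -, -⟩ := pinv_penrose (modelGram_isHermitian X M)
  set P := pinv (modelGram_isHermitian X M)
  have hG : modelGram X M = (modelMatrix M * Xᵀ) * (modelMatrix M * Xᵀ)ᵀ := by
    simp [modelGram, Matrix.transpose_mul, modelMatrix_transpose, Matrix.mul_assoc]
  have h0 : (modelGram X M * P * (modelMatrix M * Xᵀ) - modelMatrix M * Xᵀ) *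
      (modelGram X M * P * (modelMatrix M * Xᵀ) - modelMatrix M * Xᵀ)ᴴ = 0 := by
    have : (modelGram X M * P * (modelMatrix M * Xᵀ) - modelMatrix M * Xᵀ) *
        (modelMatrix M * Xᵀ)ᵀ = 0 := by
      rw [Matrix.sub_mul, Matrix.mul_assoc _ (modelMatrix M * Xᵀ), ← hG, h1, sub_self]
    rw [Matrix.conjTranspose_eq_transpose_of_trivial, Matrix.transpose_sub,
      Matrix.transpose_mul (modelGram X M * P), Matrix.mul_sub, ← Matrix.mul_assoc, this]
    simp
  rw [Matrix.self_mul_conjTranspose_eq_zero] at h0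
  exact sub_eq_zero.1 h0

theorem lse_apply_eq_zero (X : Matrix (Fin n) (Fin p) ℝ) {M : Finset (Fin p)}
    (y : EuclideanSpace ℝ (Fin n)) {j : Fin p} (hj : j ∉ M) : lse X M y j = 0 := by
  have h : lse X M y = modelMatrix M *ᵥ lse X M y := by
    rw [lse, Matrix.mulVec_mulVec, ← Matrix.mul_assoc, ← Matrix.mul_assoc, modelMatrix_mul_pinv]
  rw [h, modelMatrix, Matrix.mulVec_diagonal]
  simp [hj]

theorem meanVec_lse_mem (X : Matrix (Fin n) (Fin p) ℝ) (M : Finset (Fin p))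
    (y : EuclideanSpace ℝ (Fin n)) : meanVec X (lse X M y) ∈ modelSpace X M :=
  meanVec_mem_modelSpace X fun _ hj => lse_apply_eq_zero X y hj

theorem residual_mem_orthogonal (X : Matrix (Fin n) (Fin p) ℝ) (M : Finset (Fin p))
    (y : EuclideanSpace ℝ (Fin n)) : y - meanVec X (lse X M y) ∈ (modelSpace X M)ᗮ := by
  -- The normal equations; their coordinates j ∈ M are the inner products of the residual with the
  -- columns of the model.
  have hn : (modelMatrix M * Xᵀ) *ᵥ (y - meanVec X (lse X M y)).ofLp = 0 := by
    have hX : (modelMatrix M * Xᵀ) * (X * (pinv (modelGram_isHermitian X M) * modelMatrix M * Xᵀ)) =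
        modelMatrix M * Xᵀ := by
      conv_rhs => rw [← modelGram_mul_pinv_mul, ← modelMatrix_mul_pinv]
      generalize hP : pinv (modelGram_isHermitian X M) = P
      have hDP : modelMatrix M * P = P := hP ▸ modelMatrix_mul_pinv X M
      simp only [modelGram, Matrix.mul_assoc]
      rw [← Matrix.mul_assoc (modelMatrix M) (modelMatrix M), modelMatrix_mul_self,
        ← Matrix.mul_assoc (modelMatrix M) P, hDP]
    have : (modelMatrix M * Xᵀ) *ᵥ (X *ᵥ lse X M y) = (modelMatrix M * Xᵀ) *ᵥ y.ofLp := by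
      rw [lse, Matrix.mulVec_mulVec, Matrix.mulVec_mulVec, Matrix.mul_assoc _ X, hX]
    rw [WithLp.ofLp_sub, Matrix.mulVec_sub, meanVec, this, sub_self]
  rw [modelSpace, Submodule.mem_orthogonal]
  intro u hu
  induction hu using Submodule.span_induction with
  | zero => simp
  | add a b _ _ ha hb => rw [inner_add_left, ha, hb, add_zero]
  | smul c a _ ha => rw [inner_smul_left, ha, mul_zero]
  | mem a ha =>
    obtain ⟨j, hj, rfl⟩ := ha
    have h := congrFun hn j
    rw [← Matrix.mulVec_mulVec, modelMatrix, Matrix.mulVec_diagonal, if_pos (by simpa using hj),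
      one_mul] at h
    rw [← Pi.zero_apply (M := fun _ => ℝ) j, ← h, EuclideanSpace.inner_eq_star_dotProduct,
      dotProduct_comm]
    rfl

theorem norm_residual_le (X : Matrix (Fin n) (Fin p) ℝ) (M : Finset (Fin p))
    (y : EuclideanSpace ℝ (Fin n)) {v : EuclideanSpace ℝ (Fin n)} (hv : v ∈ modelSpace X M) :
    ‖y - meanVec X (lse X M y)‖ ^ 2 ≤ ‖y - v‖ ^ 2 := by
  have h := norm_add_sq_real (y - meanVec X (lse X M y)) (meanVec X (lse X M y) - v)
  rw [sub_add_sub_cancel, Submodule.inner_left_of_mem_orthogonal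
    (sub_mem (meanVec_lse_mem X M y) hv) (residual_mem_orthogonal X M y)] at h
  nlinarith [sq_nonneg ‖meanVec X (lse X M y) - v‖]

/-! ### Deterministic comparison with a reference model. -/

/-- The basic inequality for a minimizer of a penalized least squares criterion. -/
theorem sq_norm_fit_sub_le {γ σ t : ℝ} {X : Matrix (Fin n) (Fin p) ℝ} {prior : ℕ → ℝ}
    {Mhat : EuclideanSpace ℝ (Fin n) → Finset (Fin p)} (h : IsMAPSelector γ σ X prior Mhat)
    (ht : 0 < t) {M₀ : Finset (Fin p)} (hM₀ : M₀.card ≤ X.rank) {v : EuclideanSpace ℝ (Fin n)}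
    (hv : v ∈ modelSpace X M₀) (y : EuclideanSpace ℝ (Fin n))
    {S : Submodule ℝ (EuclideanSpace ℝ (Fin n))} (hS : modelSpace X (Mhat y) ⊔ modelSpace X M₀ ≤ S) :
    (1 - t⁻¹) * ‖meanVec X (lse X (Mhat y) y) - v‖ ^ 2 ≤
      t * ‖S.orthogonalProjectionOnto (y - v)‖ ^ 2 + pen γ σ p X.rank prior M₀.card -
        pen γ σ p X.rank prior (Mhat y).card := by
  have h1 := h.minimizes y M₀ hM₀
  have h2 := norm_residual_le X M₀ y hv
  simp only [mapCriterion] at h1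
  set f := meanVec X (lse X (Mhat y) y)
  have h3 : ‖y - f‖ ^ 2 = ‖y - v‖ ^ 2 - 2 * inner ℝ (y - v) (f - v) + ‖f - v‖ ^ 2 := by
    rw [← norm_sub_sq_real, sub_sub_sub_cancel_right]
  have hmem : f - v ∈ S := sub_mem
    (hS (Submodule.mem_sup_left (meanVec_lse_mem X _ y))) (hS (Submodule.mem_sup_right hv))
  have h4 : inner ℝ (y - v) (f - v) ≤ ‖S.orthogonalProjectionOnto (y - v)‖ * ‖f - v‖ := by
    have := S.inner_orthogonalProjectionOnto_eq_of_mem_right ⟨f - v, hmem⟩ (y - v)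
    rw [← this]
    exact real_inner_le_norm _ _
  set a := ‖S.orthogonalProjectionOnto (y - v)‖
  set b := ‖f - v‖
  -- Young's inequality; the `t⁻¹` share of the loss is absorbed on the left.
  have h5 : 2 * (a * b) ≤ t * a ^ 2 + t⁻¹ * b ^ 2 := by
    have h6 : t * a ^ 2 + t⁻¹ * b ^ 2 - 2 * (a * b) = t⁻¹ * (t * a - b) ^ 2 := by
      field_simp
      ring
    have h7 : 0 ≤ t⁻¹ * (t * a - b) ^ 2 := by positivity
    linarith
  linarith

/-! ### Exponential moments of projected Gaussian noise. -/

theorem integral_exp_mul_sq_gaussianReal {s : ℝ} (hs : s < 1 / 2) :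
    ∫ x, Real.exp (s * x ^ 2) ∂(gaussianReal 0 1) = (√(1 - 2 * s))⁻¹ := by
  rw [integral_gaussianReal_eq_integral_smul one_ne_zero]
  have h : ∀ x : ℝ, gaussianPDFReal 0 1 x • Real.exp (s * x ^ 2) =
      (√(2 * Real.pi))⁻¹ * Real.exp (-(1 / 2 - s) * x ^ 2) := by
    intro x
    rw [gaussianPDFReal, smul_eq_mul, mul_assoc, ← Real.exp_add]
    simp only [NNReal.coe_one, mul_one, sub_zero]
    congr 2
    ring
  simp_rw [h]
  rw [integral_const_mul, integral_gaussian, ← Real.sqrt_inv, ← Real.sqrt_inv, ← Real.sqrt_mul]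
  · congr 1
    have : (1 / 2 - s) ≠ 0 := by linarith
    have : (1 - 2 * s) ≠ 0 := by linarith
    have := Real.pi_ne_zero
    field_simp
  · positivity

theorem lintegral_exp_mul_sq_norm_stdGaussian {E : Type*} [NormedAddCommGroup E]
    [InnerProductSpace ℝ E] [FiniteDimensional ℝ E] [MeasurableSpace E] [BorelSpace E]
    {s : ℝ} (hs : s < 1 / 2) :
    ∫⁻ x, ENNReal.ofReal (Real.exp (s * ‖x‖ ^ 2)) ∂(stdGaussian E) =
      ENNReal.ofReal ((√(1 - 2 * s))⁻¹ ^ Module.finrank ℝ E) := by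
  have hpos : 0 < (√(1 - 2 * s))⁻¹ := by
    have : 0 < 1 - 2 * s := by linarith
    positivity
  have hi : ∫ x : Fin (Module.finrank ℝ E) → ℝ, ∏ i, Real.exp (s * x i ^ 2)
      ∂(Measure.pi fun _ => gaussianReal 0 1) = (√(1 - 2 * s))⁻¹ ^ Module.finrank ℝ E := by
    rw [integral_fintype_prod_eq_prod (f := fun _ x => Real.exp (s * x ^ 2))]
    simp [integral_exp_mul_sq_gaussianReal hs]
  rw [stdGaussian, lintegral_map (by fun_prop) (by fun_prop), ← hi,
    ofReal_integral_eq_lintegral_ofReal]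
  · refine lintegral_congr fun x => ?_
    have hx : ‖∑ i, x i • stdOrthonormalBasis ℝ E i‖ ^ 2 = ∑ i, x i ^ 2 := by
      rw [← (stdOrthonormalBasis ℝ E).sum_sq_norm_inner_right]
      simp [(stdOrthonormalBasis ℝ E).orthonormal.inner_right_fintype]
    rw [hx, Finset.mul_sum, Real.exp_sum]
  -- The Bochner integral of a non-integrable function is 0 by convention, so a nonzero value proves
  -- integrability.
  · refine Integrable.of_integral_ne_zero ?_
    rw [hi]
    positivity
  · exact Filter.Eventually.of_forall fun x => Finset.prod_nonneg fun i _ => (Real.exp_pos _).le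

/-- For t ∈ S, ⟨P_S x, t⟩ = ⟨x, t⟩, so both characteristic functions at t are the same function of
‖t‖. -/
theorem map_orthogonalProjectionOnto_stdGaussian {E : Type*} [NormedAddCommGroup E]
    [InnerProductSpace ℝ E] [FiniteDimensional ℝ E] [MeasurableSpace E] [BorelSpace E]
    (S : Submodule ℝ E) :
    (stdGaussian E).map S.orthogonalProjectionOnto = stdGaussian S := by
  have : IsProbabilityMeasure ((stdGaussian E).map S.orthogonalProjectionOnto) :=
    Measure.isProbabilityMeasure_map (by fun_prop)
  apply Measure.ext_of_charFun
  ext t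
  rw [charFun_stdGaussian, charFun_apply, integral_map (by fun_prop) (by fun_prop)]
  simp_rw [S.inner_orthogonalProjectionOnto_eq_of_mem_right]
  rw [← charFun_apply, charFun_stdGaussian, Submodule.coe_norm]

open scoped MatrixOrder in
theorem obsLaw_eq_map (X : Matrix (Fin n) (Fin p) ℝ) {σ : ℝ} (hσ : 0 ≤ σ) (β : Fin p → ℝ) :
    obsLaw X σ β = (stdGaussian (EuclideanSpace ℝ (Fin n))).map
      (fun x => meanVec X β + σ • x) := by
  have h : CFC.sqrt (σ ^ 2 • (1 : Matrix (Fin n) (Fin n) ℝ)) = σ • 1 := by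
    refine CFC.sqrt_unique ?_ ?_
    · rw [smul_mul_smul_comm, mul_one, pow_two]
    · exact smul_nonneg hσ zero_le_one
  rw [obsLaw, multivariateGaussian, h]
  congr 1
  ext1 x
  simp

instance (X : Matrix (Fin n) (Fin p) ℝ) (σ : ℝ) (β : Fin p → ℝ) :
    IsProbabilityMeasure (obsLaw X σ β) := by
  unfold obsLaw
  infer_instance

theorem lintegral_exp_sq_norm_projection (X : Matrix (Fin n) (Fin p) ℝ) {σ s : ℝ} (hσ : 0 < σ)
    (hs : s < 1 / 2) (β : Fin p → ℝ) (S : Submodule ℝ (EuclideanSpace ℝ (Fin n))) :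
    ∫⁻ y, ENNReal.ofReal
        (Real.exp (s / σ ^ 2 * ‖S.orthogonalProjectionOnto (y - meanVec X β)‖ ^ 2))
        ∂(obsLaw X σ β) =
      ENNReal.ofReal ((√(1 - 2 * s))⁻¹ ^ Module.finrank ℝ S) := by
  rw [obsLaw_eq_map X hσ.le, lintegral_map (by fun_prop) (by fun_prop),
    ← lintegral_exp_mul_sq_norm_stdGaussian hs, ← map_orthogonalProjectionOnto_stdGaussian S,
    lintegral_map (by fun_prop) (by fun_prop)]
  refine lintegral_congr fun x => ?_
  rw [add_sub_cancel_left, map_smul, norm_smul, mul_pow, Real.norm_eq_abs, sq_abs]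
  congr 2
  field_simp

/-! ### Penalty and log-complexity. -/

/-- The number of distinct fits of size `k` divided by the prior probability of the size `k`. -/
def complexity (p r : ℕ) (prior : ℕ → ℝ) (k : ℕ) : ℝ :=
  (if k = r then 1 else (p.choose k : ℝ)) * (prior k)⁻¹

theorem complexity_pos {r : ℕ} {prior : ℕ → ℝ} (hprior : IsSizePrior r prior) (hr : r ≤ p)
    {k : ℕ} (hk : k ≤ r) : 0 < complexity p r prior k := by
  have h1 := hprior.pos k hk
  have h2 : (0 : ℝ) < p.choose k := by exact_mod_cast Nat.choose_pos (hk.trans hr)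
  unfold complexity
  split_ifs <;> positivity

theorem pen_eq {γ : ℝ} (hγ : 0 < γ) (σ : ℝ) {r : ℕ} {prior : ℕ → ℝ}
    (hprior : IsSizePrior r prior) (hr : r ≤ p) {k : ℕ} (hk : k ≤ r) :
    pen γ σ p r prior k = 2 * σ ^ 2 * (1 + 1 / γ) *
      (Real.log (complexity p r prior k) + k / 2 * Real.log (1 + γ)) := by
  have h := complexity_pos hprior hr hk
  rw [pen, ← complexity, Real.log_mul h.ne' (by positivity), Real.log_rpow (by positivity)]

/-- This is (P) after taking logarithms, its two clauses matching the two cases of `complexity`. -/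
theorem cGamma_mul_le_log_complexity {γ : ℝ} {r : ℕ} {prior : ℕ → ℝ}
    (hprior : IsSizePrior r prior) (hP : AssumptionP γ p r prior) (hr : r ≤ p) {k : ℕ}
    (hk : k ≤ r) : cGamma γ * k ≤ Real.log (complexity p r prior k) := by
  rw [Real.le_log_iff_exp_le (complexity_pos hprior hr hk), complexity, ← div_eq_mul_inv,
    le_div_iff₀ (hprior.pos k hk), ← le_div_iff₀' (Real.exp_pos _), div_eq_mul_inv, ← Real.exp_neg,
    ← neg_mul]
  split_ifs with h
  · rw [h, one_mul]
    exact hP.2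
  · exact hP.1 k (lt_of_le_of_ne hk h)

theorem cGamma_pos {γ : ℝ} (hγ : 0 < γ) : 0 < cGamma γ := by
  unfold cGamma
  positivity

theorem pen_nonneg {γ : ℝ} (hγ : 0 < γ) (σ : ℝ) {r : ℕ} {prior : ℕ → ℝ}
    (hprior : IsSizePrior r prior) (hP : AssumptionP γ p r prior) (hr : r ≤ p) {k : ℕ}
    (hk : k ≤ r) : 0 ≤ pen γ σ p r prior k := by
  rw [pen_eq hγ σ hprior hr hk]
  have h1 := cGamma_mul_le_log_complexity hprior hP hr hk
  have h2 := cGamma_pos hγ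
  have h3 : 0 ≤ Real.log (1 + γ) := Real.log_nonneg (by linarith)
  have h4 : 0 ≤ Real.log (complexity p r prior k) := le_trans (by positivity) h1
  positivity

/-- The centred and scaled stochastic term of a fit of size `k` with error space `S`, where `m` is
the size of the reference model. -/
def excess (γ σ : ℝ) (X : Matrix (Fin n) (Fin p) ℝ) (prior : ℕ → ℝ) (m : ℕ)
    (v : EuclideanSpace ℝ (Fin n)) (k : ℕ) (S : Submodule ℝ (EuclideanSpace ℝ (Fin n)))
    (y : EuclideanSpace ℝ (Fin n)) : ℝ :=
  γ / (1 + 2 * γ) / σ ^ 2 * (‖S.orthogonalProjectionOnto (y - v)‖ ^ 2 -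
    (4 * γ + 3) / (4 * (γ + 1)) * pen γ σ p X.rank prior k) - m / 2 * Real.log (1 + 2 * γ)

theorem measurable_excess (γ σ : ℝ) (X : Matrix (Fin n) (Fin p) ℝ) (prior : ℕ → ℝ) (m : ℕ)
    (v : EuclideanSpace ℝ (Fin n)) (k : ℕ) (S : Submodule ℝ (EuclideanSpace ℝ (Fin n))) :
    Measurable (excess γ σ X prior m v k S) := by
  unfold excess
  fun_prop

/-- After rescaling, the penalty carries the factor 1 + 1/(4γ + 2). The surplus of log-complexity
pays for replacing log(1 + γ) by log(1 + 2γ), which costs at most k/2. -/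
theorem log_complexity_le_pen {γ σ : ℝ} (hγ : 0 < γ) (hσ : 0 < σ) {r : ℕ} {prior : ℕ → ℝ}
    (hprior : IsSizePrior r prior) (hP : AssumptionP γ p r prior) (hr : r ≤ p) {k : ℕ}
    (hk : k ≤ r) :
    Real.log (complexity p r prior k) + k / 2 * Real.log (1 + 2 * γ) ≤
      γ / (1 + 2 * γ) / σ ^ 2 * ((4 * γ + 3) / (4 * (γ + 1)) * pen γ σ p r prior k) := by
  have h1 := cGamma_mul_le_log_complexity hprior hP hr hk
  rw [pen_eq hγ σ hprior hr hk]
  set a := Real.log (complexity p r prior k)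
  have h2 : 0 ≤ Real.log (1 + γ) := Real.log_nonneg (by linarith)
  have h3 : Real.log (1 + 2 * γ) ≤ Real.log (1 + γ) + 1 := by
    have h4 := Real.log_le_sub_one_of_pos (x := (1 + 2 * γ) / (1 + γ)) (by positivity)
    rw [Real.log_div (by positivity) (by positivity)] at h4
    have h5 : (1 + 2 * γ) / (1 + γ) ≤ 2 := by
      rw [div_le_iff₀ (by positivity)]
      linarith
    linarith
  have hq : γ / (1 + 2 * γ) / σ ^ 2 * ((4 * γ + 3) / (4 * (γ + 1)) *
      (2 * σ ^ 2 * (1 + 1 / γ) * (a + k / 2 * Real.log (1 + γ)))) =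
      (1 + 1 / (4 * γ + 2)) * (a + k / 2 * Real.log (1 + γ)) := by
    field_simp
    ring
  rw [hq]
  have hc : 2 * γ + 1 ≤ cGamma γ := by
    unfold cGamma
    nlinarith [sq_nonneg γ]
  have hk0 : (0 : ℝ) ≤ k := k.cast_nonneg
  -- Assumption (P) enters here, through c(γ) ≥ 2γ + 1 only.
  have h6 : (k : ℝ) / 2 ≤ 1 / (4 * γ + 2) * a := by
    rw [one_div_mul_eq_div, le_div_iff₀ (by positivity)]
    nlinarith
  have h7 : 0 ≤ 1 / (4 * γ + 2) * (k / 2 * Real.log (1 + γ)) := by positivity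
  nlinarith

/-! ### Uniform control of the noise over all models. -/

/-- At s = γ/(1 + 2γ) each degree of freedom contributes √(1 + 2γ). The centring in `excess` cancels
the `m` reference dimensions, and `log_complexity_le_pen` handles the other `k`. -/
theorem lintegral_exp_excess_le {γ σ : ℝ} (hγ : 0 < γ) (hσ : 0 < σ) {X : Matrix (Fin n) (Fin p) ℝ}
    {prior : ℕ → ℝ} (hprior : IsSizePrior X.rank prior) (hP : AssumptionP γ p X.rank prior)
    (hr : X.rank ≤ p) (m : ℕ) (β : Fin p → ℝ) {k : ℕ} (hk : k ≤ X.rank)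
    {S : Submodule ℝ (EuclideanSpace ℝ (Fin n))} (hS : Module.finrank ℝ S ≤ k + m) :
    ∫⁻ y, ENNReal.ofReal (Real.exp (excess γ σ X prior m (meanVec X β) k S y)) ∂(obsLaw X σ β) ≤
      ENNReal.ofReal (complexity p X.rank prior k)⁻¹ := by
  set s := γ / (1 + 2 * γ) with hs_def
  have hs : s < 1 / 2 := by
    rw [hs_def, div_lt_iff₀ (by positivity)]
    linarith
  have hone : 1 - 2 * s = (1 + 2 * γ)⁻¹ := by
    rw [hs_def]
    field_simp
    ring
  have hroot : (√(1 - 2 * s))⁻¹ = Real.exp (Real.log (1 + 2 * γ) / 2) := by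
    rw [hone, Real.sqrt_inv, inv_inv, Real.exp_half, Real.exp_log (by positivity)]
  have hlog : 0 ≤ Real.log (1 + 2 * γ) := Real.log_nonneg (by linarith)
  set d := s / σ ^ 2 * ((4 * γ + 3) / (4 * (γ + 1)) * pen γ σ p X.rank prior k) with hd
  have hsplit : ∀ y, ENNReal.ofReal (Real.exp (excess γ σ X prior m (meanVec X β) k S y)) =
      ENNReal.ofReal (Real.exp (-d - m / 2 * Real.log (1 + 2 * γ))) * ENNReal.ofReal
        (Real.exp (s / σ ^ 2 * ‖S.orthogonalProjectionOnto (y - meanVec X β)‖ ^ 2)) := by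
    intro y
    rw [← ENNReal.ofReal_mul (Real.exp_pos _).le, ← Real.exp_add, excess, hd]
    congr 2
    ring
  simp_rw [hsplit]
  rw [lintegral_const_mul _ (by fun_prop), lintegral_exp_sq_norm_projection X hσ hs,
    ← ENNReal.ofReal_mul (Real.exp_pos _).le, hroot, ← Real.exp_nat_mul, ← Real.exp_add]
  refine ENNReal.ofReal_le_ofReal ?_
  rw [← Real.exp_log (complexity_pos hprior hr hk), ← Real.exp_neg, Real.exp_le_exp]
  have h := log_complexity_le_pen hγ hσ hprior hP hr hk
  have hS' : (Module.finrank ℝ S : ℝ) ≤ k + m := by exact_mod_cast hS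
  nlinarith

/-- The sum of the exponential excesses over all models, where the models of full size are
represented by the range of the design. -/
def totalExcess (γ σ : ℝ) (X : Matrix (Fin n) (Fin p) ℝ) (prior : ℕ → ℝ) (M₀ : Finset (Fin p))
    (v y : EuclideanSpace ℝ (Fin n)) : ENNReal :=
  (∑ k ∈ Finset.range X.rank, ∑ M ∈ Finset.powersetCard k Finset.univ,
    ENNReal.ofReal (Real.exp
      (excess γ σ X prior M₀.card v k (modelSpace X M ⊔ modelSpace X M₀) y))) +
    ENNReal.ofReal (Real.exp
      (excess γ σ X prior M₀.card v X.rank (modelSpace X Finset.univ) y))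

theorem measurable_totalExcess (γ σ : ℝ) (X : Matrix (Fin n) (Fin p) ℝ) (prior : ℕ → ℝ)
    (M₀ : Finset (Fin p)) (v : EuclideanSpace ℝ (Fin n)) :
    Measurable (totalExcess γ σ X prior M₀ v) := by
  have := fun k S => measurable_excess γ σ X prior M₀.card v k S
  unfold totalExcess
  fun_prop

theorem finrank_sup_modelSpace_le (X : Matrix (Fin n) (Fin p) ℝ) (M N : Finset (Fin p)) :
    Module.finrank ℝ (modelSpace X M ⊔ modelSpace X N : Submodule ℝ _) ≤ M.card + N.card :=
  (Submodule.finrank_add_le_finrank_add_finrank _ _).trans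
    (add_le_add (finrank_modelSpace_le X M) (finrank_modelSpace_le X N))

theorem lintegral_totalExcess_le_one {γ σ : ℝ} (hγ : 0 < γ) (hσ : 0 < σ)
    {X : Matrix (Fin n) (Fin p) ℝ} {prior : ℕ → ℝ} (hprior : IsSizePrior X.rank prior)
    (hP : AssumptionP γ p X.rank prior) (hr : X.rank ≤ p) (M₀ : Finset (Fin p)) (β : Fin p → ℝ) :
    ∫⁻ y, totalExcess γ σ X prior M₀ (meanVec X β) y ∂(obsLaw X σ β) ≤ 1 := by
  have hm := fun k S => measurable_excess γ σ X prior M₀.card (meanVec X β) k S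
  have hexp := fun {k : ℕ} (hk : k ≤ X.rank) {S : Submodule ℝ (EuclideanSpace ℝ (Fin n))} =>
    lintegral_exp_excess_le (S := S) hγ hσ hprior hP hr M₀.card β hk
  unfold totalExcess
  rw [lintegral_add_right _ (by fun_prop), lintegral_finsetSum _ (by fun_prop)]
  calc _ ≤ (∑ k ∈ Finset.range X.rank, ENNReal.ofReal (prior k)) +
        ENNReal.ofReal (prior X.rank) := by
        refine add_le_add (Finset.sum_le_sum fun k hk => ?_) ?_
        · have hk := Finset.mem_range.1 hk
          rw [lintegral_finsetSum _ (by fun_prop)]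
          calc _ ≤ ∑ M ∈ Finset.powersetCard k (Finset.univ : Finset (Fin p)),
                ENNReal.ofReal (complexity p X.rank prior k)⁻¹ := by
                refine Finset.sum_le_sum fun M hM => hexp hk.le ?_
                rw [← (Finset.mem_powersetCard.1 hM).2]
                exact finrank_sup_modelSpace_le X M M₀
            _ = ENNReal.ofReal (prior k) := by
                have hc : (p.choose k : ℝ) ≠ 0 := by
                  exact_mod_cast (Nat.choose_pos (hk.le.trans hr)).ne'
                rw [Finset.sum_const, Finset.card_powersetCard, Finset.card_univ, Fintype.card_fin,
                  ← ENNReal.ofReal_nsmul, complexity, if_neg hk.ne, nsmul_eq_mul]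
                congr 1
                field_simp
        -- The saturated term is a single one, so no binomial coefficient is needed to pay for it.
        · refine (hexp le_rfl ?_).trans (le_of_eq ?_)
          · rw [finrank_modelSpace_univ]
            exact Nat.le_add_right _ _
          · simp [complexity]
    _ = 1 := by
        rw [← Finset.sum_range_succ, ← ENNReal.ofReal_sum_of_nonneg, hprior.sum_eq_one,
          ENNReal.ofReal_one]
        exact fun k hk => (hprior.pos k (Finset.mem_range_succ_iff.1 hk)).le

/-- Lets the data-dependent model be inserted: below full size S is the sum of the two spans, at
full size the whole column space. -/
theorem exp_excess_le_totalExcess (γ σ : ℝ) {X : Matrix (Fin n) (Fin p) ℝ} (prior : ℕ → ℝ)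
    {M : Finset (Fin p)} (hM : M.card ≤ X.rank) (M₀ : Finset (Fin p))
    (v y : EuclideanSpace ℝ (Fin n)) :
    ∃ S, modelSpace X M ⊔ modelSpace X M₀ ≤ S ∧
      ENNReal.ofReal (Real.exp (excess γ σ X prior M₀.card v M.card S y)) ≤
        totalExcess γ σ X prior M₀ v y := by
  rcases hM.lt_or_eq with h | h
  · refine ⟨_, le_rfl, le_trans ?_ le_self_add⟩
    refine le_trans ?_ (Finset.single_le_sum (fun _ _ => zero_le) (Finset.mem_range.2 h))
    exact Finset.single_le_sum (f := fun M' => ENNReal.ofReal (Real.exp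
      (excess γ σ X prior M₀.card v M.card (modelSpace X M' ⊔ modelSpace X M₀) y)))
      (fun _ _ => zero_le) (Finset.mem_powersetCard.2 ⟨Finset.subset_univ M, rfl⟩)
  · refine ⟨modelSpace X Finset.univ, sup_le (modelSpace_mono X (Finset.subset_univ _))
      (modelSpace_mono X (Finset.subset_univ _)), ?_⟩
    rw [h]
    exact le_add_self

/-! ### The oracle inequality. -/

/-- The oracle inequality: the risk is bounded by the dimension and the penalty of any model that
contains the mean vector. -/
theorem risk_le {γ σ : ℝ} (hγ : 0 < γ) (hσ : 0 < σ)
    {X : Matrix (Fin n) (Fin p) ℝ} {prior : ℕ → ℝ} (hprior : IsSizePrior X.rank prior)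
    (hP : AssumptionP γ p X.rank prior) (hr : X.rank ≤ p)
    {Mhat : EuclideanSpace ℝ (Fin n) → Finset (Fin p)} (h : IsMAPSelector γ σ X prior Mhat)
    {M₀ : Finset (Fin p)} (hM₀ : M₀.card ≤ X.rank) {β : Fin p → ℝ}
    (hβ : meanVec X β ∈ modelSpace X M₀) :
    risk σ X Mhat β ≤ ENNReal.ofReal (4 * (γ + 1) *
      (4 * (γ + 1) / (4 * γ + 3) * ((1 + 2 * γ) / γ) * σ ^ 2 *
        (1 + M₀.card / 2 * Real.log (1 + 2 * γ)) + pen γ σ p X.rank prior M₀.card)) := by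
  -- K = tσ²/s with t = 4(γ + 1)/(4γ + 3) and s = γ/(1 + 2γ): it undoes the scaling in `excess`.
  set K := 4 * (γ + 1) / (4 * γ + 3) * ((1 + 2 * γ) / γ) * σ ^ 2 with hK_def
  have hK : 0 ≤ K := by positivity
  have hlog : 0 ≤ Real.log (1 + 2 * γ) := Real.log_nonneg (by linarith)
  have hpen := pen_nonneg hγ σ hprior hP hr hM₀
  set B := 4 * (γ + 1) * (K * (M₀.card / 2 * Real.log (1 + 2 * γ)) +
    pen γ σ p X.rank prior M₀.card) with hB_def
  have hB : 0 ≤ B := by positivity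
  have hpt : ∀ y, ENNReal.ofReal (‖meanVec X (lse X (Mhat y) y) - meanVec X β‖ ^ 2) ≤
      ENNReal.ofReal B + ENNReal.ofReal (4 * (γ + 1) * K) *
        totalExcess γ σ X prior M₀ (meanVec X β) y := by
    intro y
    obtain ⟨S, hS, hle⟩ :=
      exp_excess_le_totalExcess γ σ prior (h.card_le y) M₀ (meanVec X β) y
    refine le_trans ?_ (add_le_add_right (mul_le_mul_right hle _) _)
    rw [← ENNReal.ofReal_mul (by positivity), ← ENNReal.ofReal_add hB (by positivity)]
    refine ENNReal.ofReal_le_ofReal ?_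
    have h1 := sq_norm_fit_sub_le h (t := 4 * (γ + 1) / (4 * γ + 3)) (by positivity) hM₀ hβ y hS
    have h2 : excess γ σ X prior M₀.card (meanVec X β) (Mhat y).card S y ≤
        Real.exp (excess γ σ X prior M₀.card (meanVec X β) (Mhat y).card S y) := by
      linarith [Real.add_one_le_exp (excess γ σ X prior M₀.card (meanVec X β) (Mhat y).card S y)]
    have h3 : K * (excess γ σ X prior M₀.card (meanVec X β) (Mhat y).card S y +
        M₀.card / 2 * Real.log (1 + 2 * γ)) =
        4 * (γ + 1) / (4 * γ + 3) * ‖S.orthogonalProjectionOnto (y - meanVec X β)‖ ^ 2 -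
          pen γ σ p X.rank prior (Mhat y).card := by
      rw [hK_def, excess]
      field_simp
      ring
    have h4 : 1 - (4 * (γ + 1) / (4 * γ + 3))⁻¹ = (4 * (γ + 1))⁻¹ := by
      field_simp
      ring
    rw [h4, inv_mul_le_iff₀ (by positivity)] at h1
    refine h1.trans ?_
    rw [hB_def, mul_assoc (4 * (γ + 1)) K, ← mul_add]
    refine mul_le_mul_of_nonneg_left ?_ (by positivity)
    have h5 := mul_le_mul_of_nonneg_left h2 hK
    linarith
  calc risk σ X Mhat β ≤ ∫⁻ y, (ENNReal.ofReal B + ENNReal.ofReal (4 * (γ + 1) * K) *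
        totalExcess γ σ X prior M₀ (meanVec X β) y) ∂(obsLaw X σ β) := lintegral_mono hpt
    _ ≤ ENNReal.ofReal B + ENNReal.ofReal (4 * (γ + 1) * K) * 1 := by
        rw [lintegral_add_left measurable_const, lintegral_const, measure_univ, mul_one,
          lintegral_const_mul _ (measurable_totalExcess γ σ X prior M₀ _)]
        gcongr
        exact lintegral_totalExcess_le_one hγ hσ hprior hP hr M₀ β
    _ = _ := by
        rw [mul_one, ← ENNReal.ofReal_add hB (by positivity), hB_def]
        congr 1
        ring

/-! ### From the oracle inequality to the rates. -/

/-- The constant of the risk bound when the log-complexity is at most `D` times the rate. -/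
def riskConst (γ D : ℝ) : ℝ :=
  4 * (γ + 1) * (4 * (γ + 1) / (4 * γ + 3) * ((1 + 2 * γ) / γ) *
    (1 + 1 / 2 * Real.log (1 + 2 * γ)) + 2 * (1 + 1 / γ) * (D + 1 / 2 * Real.log (1 + γ)))

theorem riskConst_pos {γ D : ℝ} (hγ : 0 < γ) (hD : 0 < D) : 0 < riskConst γ D := by
  have h1 : 0 ≤ Real.log (1 + 2 * γ) := Real.log_nonneg (by linarith)
  have h2 : 0 ≤ Real.log (1 + γ) := Real.log_nonneg (by linarith)
  unfold riskConst
  positivity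

theorem risk_le_riskConst {γ σ : ℝ} (hγ : 0 < γ) (hσ : 0 < σ)
    {X : Matrix (Fin n) (Fin p) ℝ} {prior : ℕ → ℝ} (hprior : IsSizePrior X.rank prior)
    (hP : AssumptionP γ p X.rank prior) (hr : X.rank ≤ p)
    {Mhat : EuclideanSpace ℝ (Fin n) → Finset (Fin p)} (h : IsMAPSelector γ σ X prior Mhat)
    {M₀ : Finset (Fin p)} (hM₀ : M₀.card ≤ X.rank) {β : Fin p → ℝ}
    (hβ : meanVec X β ∈ modelSpace X M₀) {B D : ℝ} (hB : 1 ≤ B) (hMB : M₀.card ≤ B)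
    (hD : Real.log (complexity p X.rank prior M₀.card) ≤ D * B) :
    risk σ X Mhat β ≤ ENNReal.ofReal (riskConst γ D * σ ^ 2 * B) := by
  refine (risk_le hγ hσ hprior hP hr h hM₀ hβ).trans (ENNReal.ofReal_le_ofReal ?_)
  have h1 : 0 ≤ Real.log (1 + 2 * γ) := Real.log_nonneg (by linarith)
  have h2 : 0 ≤ Real.log (1 + γ) := Real.log_nonneg (by linarith)
  rw [pen_eq hγ σ hprior hr hM₀]
  calc _ ≤ 4 * (γ + 1) * (4 * (γ + 1) / (4 * γ + 3) * ((1 + 2 * γ) / γ) * σ ^ 2 *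
        (B + B / 2 * Real.log (1 + 2 * γ)) + 2 * σ ^ 2 * (1 + 1 / γ) *
          (D * B + B / 2 * Real.log (1 + γ))) := by gcongr
    _ = _ := by
        rw [riskConst]
        ring

/-- C(p,k) ≤ pᵏ/k! and kᵏ/k! ≤ eᵏ. -/
theorem log_choose_le {k : ℕ} (hk : 0 < k) (hkp : k ≤ p) :
    Real.log (p.choose k) ≤ k * (Real.log (p / k) + 1) := by
  have hk0 : (0 : ℝ) < k := by exact_mod_cast hk
  have hp0 : (0 : ℝ) < p := by exact_mod_cast hk.trans_le hkp
  have hc : (0 : ℝ) < p.choose k := by exact_mod_cast Nat.choose_pos hkp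
  have h1 : (p.choose k : ℝ) ≤ (p / k * Real.exp 1) ^ k := by
    refine (Nat.choose_le_pow_div k p).trans ?_
    have h2 := Real.pow_div_factorial_le_exp (k : ℝ) hk0.le k
    rw [mul_pow, div_pow, ← Real.exp_nat_mul, mul_one]
    calc (p : ℝ) ^ k / k.factorial = p ^ k / k ^ k * (k ^ k / k.factorial) := by field_simp
      _ ≤ _ := by gcongr
  refine (Real.log_le_log hc h1).trans (le_of_eq ?_)
  rw [Real.log_pow, Real.log_mul (by positivity) (Real.exp_pos 1).ne', Real.log_exp]

theorem le_mul_log_div_add_one {k : ℕ} (hk : 0 < k) (hkp : k ≤ p) :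
    (k : ℝ) ≤ k * (Real.log (p / k) + 1) := by
  have hk0 : (0 : ℝ) < k := by exact_mod_cast hk
  have h : 0 ≤ Real.log ((p : ℝ) / k) :=
    Real.log_nonneg (by rw [one_le_div hk0]; exact_mod_cast hkp)
  nlinarith

theorem log_complexity_le_of_lt {r : ℕ} {prior : ℕ → ℝ} {k : ℕ} {c : ℝ} (hprior : 0 < prior k)
    (hk : 0 < k) (hkr : k < r) (hr : r ≤ p)
    (h : ((k : ℝ) / (p * Real.exp 1)) ^ (c * k) ≤ prior k) :
    Real.log (complexity p r prior k) ≤ (1 + c) * (k * (Real.log (p / k) + 1)) := by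
  have hkp : k ≤ p := hkr.le.trans hr
  have hk0 : (0 : ℝ) < k := by exact_mod_cast hk
  have hp0 : (0 : ℝ) < p := by exact_mod_cast hk.trans_le hkp
  have hc : (0 : ℝ) < p.choose k := by exact_mod_cast Nat.choose_pos hkp
  have h1 := Real.log_le_log (by positivity) h
  rw [Real.log_rpow (by positivity), Real.log_div (by positivity) (by positivity),
    Real.log_mul (by positivity) (Real.exp_pos 1).ne', Real.log_exp] at h1
  have h2 := log_choose_le hk hkp
  rw [complexity, if_neg hkr.ne, Real.log_mul hc.ne' (inv_pos.2 hprior).ne', Real.log_inv]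
  rw [Real.log_div (by positivity) (by positivity)] at h2 ⊢
  linarith

theorem log_complexity_rank_le {r : ℕ} {prior : ℕ → ℝ} {c : ℝ}
    (h : Real.exp (-c * r) ≤ prior r) : Real.log (complexity p r prior r) ≤ c * r := by
  have h1 := Real.log_le_log (Real.exp_pos _) h
  rw [Real.log_exp] at h1
  rw [complexity, if_pos rfl, one_mul, Real.log_inv]
  linarith

/-- The support is padded to size exactly `k`, because the lower bound on the prior is given at p₀
and not at smaller sizes. -/
theorem exists_model_card_eq {β : Fin p → ℝ} {k : ℕ} (hβ : hammingNorm β ≤ k) (hk : k ≤ p) :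
    ∃ M : Finset (Fin p), M.card = k ∧ ∀ j ∉ M, β j = 0 := by
  obtain ⟨M, hM, hcard⟩ := Finset.exists_superset_card_eq
    (s := Finset.univ.filter fun j => β j ≠ 0) hβ (by simpa using hk)
  refine ⟨M, hcard, fun j hj => ?_⟩
  by_contra h
  exact hj (hM (by simpa using h))

/-- By general position any r columns span every mean vector, so sparsity of β plays no role. The
slack D = 1 + c matches the constant of the sparse rate. -/
theorem risk_le_rank_rate {γ σ c : ℝ} (hγ : 0 < γ) (hσ : 0 < σ)
    {X : Matrix (Fin n) (Fin p) ℝ} (hX : ColumnsInGeneralPosition X) {prior : ℕ → ℝ}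
    (hprior : IsSizePrior X.rank prior) (hP : AssumptionP γ p X.rank prior) (hr : X.rank ≤ p)
    {Mhat : EuclideanSpace ℝ (Fin n) → Finset (Fin p)} (h : IsMAPSelector γ σ X prior Mhat)
    (hr1 : 1 ≤ X.rank) (hfull : Real.exp (-c * X.rank) ≤ prior X.rank) (β : Fin p → ℝ) :
    risk σ X Mhat β ≤ ENNReal.ofReal (riskConst γ (1 + c) * σ ^ 2 * X.rank) := by
  obtain ⟨M, -, hM⟩ := Finset.exists_subset_card_eq
    (s := (Finset.univ : Finset (Fin p))) (n := X.rank) (by simpa using hr)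
  refine risk_le_riskConst hγ hσ hprior hP hr h hM.le (β := β) ?_ (by exact_mod_cast hr1)
    (by rw [hM]) ?_
  · rw [modelSpace_eq_univ hX hM]
    exact meanVec_mem_modelSpace X fun j hj => absurd (Finset.mem_univ j) hj
  · rw [hM]
    have := log_complexity_rank_le (p := p) hfull
    linarith [(Nat.cast_nonneg X.rank : (0 : ℝ) ≤ X.rank)]

theorem risk_le_sparse_rate {γ σ c : ℝ} (hγ : 0 < γ) (hσ : 0 < σ) (hc : 0 < c)
    {X : Matrix (Fin n) (Fin p) ℝ} {prior : ℕ → ℝ}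
    (hprior : IsSizePrior X.rank prior) (hP : AssumptionP γ p X.rank prior) (hr : X.rank ≤ p)
    {Mhat : EuclideanSpace ℝ (Fin n) → Finset (Fin p)} (h : IsMAPSelector γ σ X prior Mhat)
    {p₀ : ℕ} (hp₀ : 1 ≤ p₀) (hp₀r : p₀ ≤ X.rank)
    (hcase : (p₀ < X.rank ∧ ((p₀ : ℝ) / (p * Real.exp 1)) ^ (c * p₀) ≤ prior p₀) ∨
      (p₀ = X.rank ∧ Real.exp (-c * X.rank) ≤ prior X.rank))
    {β : Fin p → ℝ} (hβ : hammingNorm β ≤ p₀) :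
    risk σ X Mhat β ≤
      ENNReal.ofReal (riskConst γ (1 + c) * σ ^ 2 * (p₀ * (Real.log (p / p₀) + 1))) := by
  obtain ⟨M, hM, hsupp⟩ := exists_model_card_eq hβ (hp₀r.trans hr)
  have hL := le_mul_log_div_add_one hp₀ (hp₀r.trans hr)
  have h1 : (1 : ℝ) ≤ p₀ := by exact_mod_cast hp₀
  refine risk_le_riskConst hγ hσ hprior hP hr h (hM.trans_le hp₀r)
    (meanVec_mem_modelSpace X hsupp) (h1.trans hL) (by rwa [hM]) ?_
  rw [hM]
  rcases hcase with ⟨hlt, hle⟩ | ⟨heq, hle⟩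
  · exact log_complexity_le_of_lt (hprior.pos _ hp₀r) hp₀ hlt hr hle
  -- For p₀ = r the log-complexity is at most cr, and `hL` bounds r by the sparse rate.
  · have h2 := log_complexity_rank_le (p := p) hle
    rw [← heq] at h2 ⊢
    nlinarith

end MAPSelection

end

theorem theorem3 (γ : ℝ) (hγ : 0 < γ) (c : ℝ) (hc : MAPSelection.cGamma γ < c) :
    ∃ C₁ : ℝ, 0 < C₁ ∧
      ∀ (n p : ℕ) (X : Matrix (Fin n) (Fin p) ℝ), MAPSelection.ColumnsInGeneralPosition X →
      ∀ σ : ℝ, 0 < σ →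
      ∀ prior : ℕ → ℝ, MAPSelection.IsSizePrior X.rank prior →
        MAPSelection.AssumptionP γ p X.rank prior →
      ∀ Mhat : EuclideanSpace ℝ (Fin n) → Finset (Fin p),
        MAPSelection.IsMAPSelector γ σ X prior Mhat →
      ∀ p₀ : ℕ, 1 ≤ p₀ → p₀ ≤ X.rank →
        ((p₀ < X.rank ∧ ((p₀ : ℝ) / (p * Real.exp 1)) ^ (c * p₀) ≤ prior p₀) ∨
          (p₀ = X.rank ∧ Real.exp (-c * X.rank) ≤ prior X.rank)) →
        MAPSelection.maxRisk σ X Mhat p₀ ≤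
            ENNReal.ofReal (C₁ * σ ^ 2 * (p₀ * (Real.log (p / p₀) + 1))) ∧
          (Real.exp (-c * X.rank) ≤ prior X.rank →
            MAPSelection.maxRisk σ X Mhat p₀ ≤
              ENNReal.ofReal
                (C₁ * σ ^ 2 * min (p₀ * (Real.log (p / p₀) + 1)) (X.rank : ℝ))) := by
  have hc0 : 0 < c := (MAPSelection.cGamma_pos hγ).trans hc
  refine ⟨MAPSelection.riskConst γ (1 + c), MAPSelection.riskConst_pos hγ (by positivity), ?_⟩
  intro n p X hX σ hσ prior hprior hP Mhat hMhat p₀ hp₀ hp₀r hcase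
  have hr : X.rank ≤ p := by simpa using X.rank_le_card_width
  have hsparse : ∀ β : Fin p → ℝ, hammingNorm β ≤ p₀ → _ := fun β hβ =>
    MAPSelection.risk_le_sparse_rate hγ hσ hc0 hprior hP hr hMhat hp₀ hp₀r hcase hβ
  refine ⟨iSup₂_le hsparse, fun hfull => iSup₂_le fun β hβ => ?_⟩
  rcases min_choice ((p₀ : ℝ) * (Real.log (p / p₀) + 1)) (X.rank : ℝ) with hmin | hmin
  · rw [hmin]
    exact hsparse β hβ
  · rw [hmin]
    exact MAPSelection.risk_le_rank_rate hγ hσ hX hprior hP hr hMhat (hp₀.trans hp₀r) hfull β
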